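/- Conventions. Algebras are associative unital $\mathbb{C}$-algebras, and both actions on a bimodule induce its given $\mathbb{C}$-vector space structure. Complete locally convex spaces are Hausdorff. An Arens–Michael algebra is a complete locally convex algebra whose topology is defined by a family of submultiplicative seminorms. The Arens–Michael envelope $(\widehat A,i_A)$ of an algebra $A$ is an Arens–Michael algebra $\widehat A$ with a homomorphism $i_A:A\to\widehat A$ through which every homomorphism from $A$ to an Arens–Michael algebra factors by a unique continuous homomorphism on $\widehat A$. An $\widehat A$-$\hat\otimes$-bimodule is a complete locally convex $\widehat A$-bimodule with jointly continuous left and right actions. The Arens–Michael envelope $(\widehat M,i_M)$ of an $A$-bimodule $M$ is an $\widehat A$-$\hat\otimes$-bimodule $\widehat M$ with an $A$-bimodule homomorphism $i_M:M\to\widehat M$ through which every $A$-bimodule homomorphism from $M$ to an $\widehat A$-$\hat\otimes$-bimodule factors by a unique continuous $\widehat A$-bimodule homomorphism on $\widehat M$. The completed projective tensor product over $\widehat A$ is denoted $\hat\otimes_{\widehat A}$. For an endomorphism $\alpha$ of $A$, the $A$-bimodule $A_\alpha$ is $A$ as a left module, with right action $x\circ a=x\,\alpha(a)$. A pair of inverse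 $A$-bimodules $M$, $M^{-1}$ is given with $A$-bimodule isomorphisms (convolutions) $i_1:M\otimes_A M^{-1}\to A$ and $i_2:M^{-1}\otimes_A M\to A$ such that $$i_1(m\otimes n)\,m'=m\,i_2(n\otimes m'),\qquad i_2(n\otimes m)\,n'=n\,i_1(m\otimes n')\qquad(m,m'\in M,\ n,n'\in M^{-1}).$$ A pair of topologically inverse $\widehat A$-$\hat\otimes$-bimodules is given in the same way, with $\hat\otimes_{\widehat A}$ in place of $\otimes_A$ and with convolutions that are topological isomorphisms of $\widehat A$-$\hat\otimes$-bimodules. Proposition 2.3. Let $A$ be an algebra, let $\alpha\in\mathrm{Aut}(A)$, and let $(\widehat A,i_A)$ be the Arens–Michael envelope of $A$. (a) $A_\alpha$ and $A_{\alpha^{-1}}$ are inverse $A$-bimodules with respect to the convolutions $i_1(a\otimes b)=a\,\alpha(b)$ and $i_2(b\otimes a)=b\,\alpha^{-1}(a)$. (b) There is a topological automorphism $\hat\alpha$ of the algebra $\widehat A$ with $\hat\alpha\circ i_A=i_A\circ\alpha$, such that $\widehat A_{\hat\alpha}$ together with the map $i_A:A_\alpha\to\widehat A_{\hat\alpha}$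 is an Arens–Michael envelope of the $A$-bimodule $A_\alpha$. (c) Let $M=A_\alpha$, let $M^{-1}$ be any inverse bimodule of $M$ with convolutions $i_1,i_2$ as above, and let $(\widehat M,i_M)$ and $(\widehat{M^{-1}},i_{M^{-1}})$ be Arens–Michael envelopes of the $A$-bimodules $M$ and $M^{-1}$. Then there exist topological isomorphisms of $\widehat A$-$\hat\otimes$-bimodules $$\hat i_1:\widehat M\,\hat\otimes_{\widehat A}\,\widehat{M^{-1}}\to\widehat A,\qquad \hat i_2:\widehat{M^{-1}}\,\hat\otimes_{\widehat A}\,\widehat M\to\widehat A$$ with respect to which $\widehat M$ and $\widehat{M^{-1}}$ are topologically inverse $\widehat A$-$\hat\otimes$-bimodules, and which satisfy, for all $m\in M$ and $n\in M^{-1}$, $$\hat i_1\bigl(i_M(m)\otimes i_{M^{-1}}(n)\bigr)=i_A\bigl(i_1(m\otimes n)\bigr),\qquad \hat i_2\bigl(i_{M^{-1}}(n)\otimes i_M(m)\bigr)=i_A\bigl(i_2(n\otimes m)\bigr).$$ -/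

import Mathlib

open scoped TensorProduct
open MulOpposite UniformSpace

universe u

namespace ArensMichael

/-! Algebras are associative unital `ℂ`-algebras. A right action of `A` is an action of the
opposite algebra `Aᵐᵒᵖ`, so `m · a` is written `op a • m`. -/

section Algebraic

/-- `M` is an `A`-bimodule: the left and the right action commute, and both induce the given
complex vector space structure. -/
class IsBimodule (A M : Type u) [Ring A] [Algebra ℂ A] [AddCommGroup M] [Module ℂ M]
    [Module A M] [Module Aᵐᵒᵖ M] : Prop where
  smul_comm : SMulCommClass A Aᵐᵒᵖ M
  left_tower : IsScalarTower ℂ A M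
  right_tower : IsScalarTower ℂ Aᵐᵒᵖ M

/-- `f : M → N` is a homomorphism of bimodules over the algebra homomorphism `φ : A → B`: it is
`A`-bilinear when `A` acts on the `B`-bimodule `N` through `φ`. -/
structure IsBimoduleHom {A B M N : Type u} [Ring A] [Algebra ℂ A] [Ring B] [Algebra ℂ B]
    [AddCommGroup M] [Module ℂ M] [Module A M] [Module Aᵐᵒᵖ M]
    [AddCommGroup N] [Module ℂ N] [Module B N] [Module Bᵐᵒᵖ N]
    (φ : A →ₐ[ℂ] B) (f : M →ₗ[ℂ] N) : Prop where
  map_left : ∀ (a : A) (m : M), f (a • m) = φ a • f m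
  map_right : ∀ (a : A) (m : M), f (op a • m) = op (φ a) • f m

variable (A M N : Type u) [Ring A] [Algebra ℂ A]
  [AddCommGroup M] [Module ℂ M] [Module A M] [Module Aᵐᵒᵖ M]
  [AddCommGroup N] [Module ℂ N] [Module A N] [Module Aᵐᵒᵖ N]

/-- The subspace of `M ⊗ N` spanned by the elements `m · a ⊗ n - m ⊗ a · n`. -/
def balancing : Submodule ℂ (M ⊗[ℂ] N) :=
  Submodule.span ℂ {t | ∃ (m : M) (a : A) (n : N), t = (op a • m) ⊗ₜ[ℂ] n - m ⊗ₜ[ℂ] (a • n)}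

/-- The algebraic tensor product `M ⊗_A N` over a possibly noncommutative algebra `A`. -/
def BTensor : Type u := (M ⊗[ℂ] N) ⧸ balancing A M N

instance : AddCommGroup (BTensor A M N) :=
  inferInstanceAs (AddCommGroup ((M ⊗[ℂ] N) ⧸ balancing A M N))

instance : Module ℂ (BTensor A M N) :=
  inferInstanceAs (Module ℂ ((M ⊗[ℂ] N) ⧸ balancing A M N))

variable {M N}

/-- The elementary tensor `m ⊗ n` in `M ⊗_A N`. -/
def btmul (m : M) (n : N) : BTensor A M N := (balancing A M N).mkQ (m ⊗ₜ[ℂ] n)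

variable {A}

/-- `i₁ : M ⊗_A N ≃ A` and `i₂ : N ⊗_A M ≃ A` are convolutions, that is, isomorphisms of
`A`-bimodules making `M` and `N` mutually inverse `A`-bimodules. Bilinearity over `A` and the two
associativity squares (equalities of maps on `M ⊗_A N ⊗_A M` and on `N ⊗_A M ⊗_A N`) are written
out on elementary tensors, which span. -/
structure IsConvolutionPair (i₁ : BTensor A M N ≃ₗ[ℂ] A) (i₂ : BTensor A N M ≃ₗ[ℂ] A) :
    Prop where
  bilin₁ : ∀ (a b : A) (m : M) (n : N),
    i₁ (btmul A (a • m) (op b • n)) = a * i₁ (btmul A m n) * b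
  bilin₂ : ∀ (a b : A) (n : N) (m : M),
    i₂ (btmul A (a • n) (op b • m)) = a * i₂ (btmul A n m) * b
  assoc₁ : ∀ (m : M) (n : N) (m' : M),
    i₁ (btmul A m n) • m' = op (i₂ (btmul A n m')) • m
  assoc₂ : ∀ (n : N) (m : M) (n' : N),
    i₂ (btmul A n m) • n' = op (i₁ (btmul A m n')) • n

end Algebraic

section Twisted

variable {A : Type u} [Ring A] [Algebra ℂ A]

/-- The bimodule `A_α`: it is `A` as a left module, with right action `x · a = x α(a)`. -/
def Twisted (_α : A →ₐ[ℂ] A) : Type u := A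

variable (α : A →ₐ[ℂ] A)

namespace Twisted

instance : AddCommGroup (Twisted α) := inferInstanceAs (AddCommGroup A)
instance : Module ℂ (Twisted α) := inferInstanceAs (Module ℂ A)
instance : Module A (Twisted α) := inferInstanceAs (Module A A)
instance [UniformSpace A] : UniformSpace (Twisted α) := inferInstanceAs (UniformSpace A)
instance [UniformSpace A] [IsUniformAddGroup A] : IsUniformAddGroup (Twisted α) :=
  inferInstanceAs (IsUniformAddGroup A)

/-- The identity map from `A` to the vector space underlying `A_α`. -/
def of : A ≃ₗ[ℂ] Twisted α := LinearEquiv.refl ℂ A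

instance : Module Aᵐᵒᵖ (Twisted α) where
  smul a x := of α ((of α).symm x * α (unop a))
  one_smul x := show of α ((of α).symm x * α 1) = x by simp
  mul_smul a b x := by
    show of α ((of α).symm x * α (unop b * unop a)) =
      of α ((of α).symm (of α ((of α).symm x * α (unop b))) * α (unop a))
    simp [mul_assoc]
  smul_zero a := show of α ((of α).symm 0 * α (unop a)) = 0 by simp
  smul_add a x y := by
    show of α ((of α).symm (x + y) * α (unop a)) =
      of α ((of α).symm x * α (unop a)) + of α ((of α).symm y * α (unop a))
    simp [add_mul]
  add_smul a b x := by
    show of α ((of α).symm x * α (unop a + unop b)) =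
      of α ((of α).symm x * α (unop a)) + of α ((of α).symm x * α (unop b))
    simp [mul_add]
  zero_smul x := show of α ((of α).symm x * α 0) = 0 by simp

theorem left_smul (a x : A) : a • of α x = of α (a * x) := rfl

theorem right_smul (a x : A) : op a • of α x = of α (x * α a) := rfl

instance : IsBimodule A (Twisted α) where
  smul_comm := ⟨fun a b x => (mul_assoc a ((of α).symm x) (α (unop b))).symm⟩
  left_tower := ⟨fun c a x => smul_mul_assoc c a ((of α).symm x)⟩
  right_tower := ⟨fun c a x => by
    show of α ((of α).symm x * α (c • unop a)) = c • of α ((of α).symm x * α (unop a))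
    simp⟩

end Twisted

end Twisted

section Topological

/-- A complete Hausdorff locally convex space over `ℂ`. -/
structure IsCompleteLCS (E : Type u) [AddCommGroup E] [Module ℂ E] [UniformSpace E]
    [IsUniformAddGroup E] : Prop where
  locallyConvex : PolynormableSpace ℂ E
  hausdorff : T2Space E
  complete : CompleteSpace E

/-- An Arens-Michael algebra: a complete Hausdorff locally convex algebra whose topology is
defined by a family of submultiplicative seminorms. -/
structure IsArensMichaelAlgebra (B : Type u) [Ring B] [Algebra ℂ B] [UniformSpace B]
    [IsUniformAddGroup B] : Prop where
  completeLCS : IsCompleteLCS B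
  mConvex : ∃ S : Set (Seminorm ℂ B),
    WithSeminorms (fun p : S => (p : Seminorm ℂ B)) ∧
      ∀ p ∈ S, ∀ x y : B, p (x * y) ≤ p x * p y

/-- An Arens-Michael envelope `(Â, ι)` of the algebra `A`. -/
structure IsEnvelope {A Ahat : Type u} [Ring A] [Algebra ℂ A] [Ring Ahat] [Algebra ℂ Ahat]
    [UniformSpace Ahat] [IsUniformAddGroup Ahat] (ι : A →ₐ[ℂ] Ahat) : Prop where
  arensMichael : IsArensMichaelAlgebra Ahat
  universal : ∀ (B : Type u) [Ring B] [Algebra ℂ B] [UniformSpace B] [IsUniformAddGroup B],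
    IsArensMichaelAlgebra B → ∀ φ : A →ₐ[ℂ] B,
      ∃! g : Ahat →A[ℂ] B, ∀ a : A, g (ι a) = φ a

/-- `M` is an `A`-`⊗̂`-bimodule: a complete Hausdorff locally convex space which is an
`A`-bimodule with jointly continuous left and right actions. -/
structure IsHatBimodule (A M : Type u) [Ring A] [Algebra ℂ A] [TopologicalSpace A]
    [AddCommGroup M] [Module ℂ M] [Module A M] [Module Aᵐᵒᵖ M]
    [UniformSpace M] [IsUniformAddGroup M] : Prop where
  completeLCS : IsCompleteLCS M
  bimodule : IsBimodule A M
  continuous_left : Continuous fun x : A × M => x.1 • x.2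
  continuous_right : Continuous fun x : M × A => op x.2 • x.1

/-- An Arens-Michael envelope `(M̂, j)` of the `A`-bimodule `M`, relative to `ι : A → Â`. -/
structure IsBimoduleEnvelope {A Ahat M Mhat : Type u} [Ring A] [Algebra ℂ A]
    [Ring Ahat] [Algebra ℂ Ahat] [UniformSpace Ahat] [IsUniformAddGroup Ahat]
    [AddCommGroup M] [Module ℂ M] [Module A M] [Module Aᵐᵒᵖ M]
    [AddCommGroup Mhat] [Module ℂ Mhat] [Module Ahat Mhat] [Module Ahatᵐᵒᵖ Mhat]
    [UniformSpace Mhat] [IsUniformAddGroup Mhat]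
    (ι : A →ₐ[ℂ] Ahat) (j : M →ₗ[ℂ] Mhat) : Prop where
  hatBimodule : IsHatBimodule Ahat Mhat
  hom : IsBimoduleHom ι j
  universal : ∀ (N : Type u) [AddCommGroup N] [Module ℂ N] [Module Ahat N] [Module Ahatᵐᵒᵖ N]
    [UniformSpace N] [IsUniformAddGroup N], IsHatBimodule Ahat N →
      ∀ f : M →ₗ[ℂ] N, IsBimoduleHom ι f →
        ∃! g : Mhat →L[ℂ] N,
          IsBimoduleHom (AlgHom.id ℂ Ahat) (g : Mhat →ₗ[ℂ] N) ∧ ∀ m : M, g (j m) = f m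

variable (A M N : Type u) [Ring A] [Algebra ℂ A]
  [AddCommGroup M] [Module ℂ M] [Module A M] [Module Aᵐᵒᵖ M] [TopologicalSpace M]
  [AddCommGroup N] [Module ℂ N] [Module A N] [Module Aᵐᵒᵖ N] [TopologicalSpace N]

/-- The seminorms on `M ⊗_A N` for which the canonical map `M × N → M ⊗_A N` is jointly
continuous. They define the projective topology: the finest locally convex topology with this
property, which is the quotient of the projective topology of `M ⊗ N`. -/
def projectiveSeminorms :
    SeminormFamily ℂ (BTensor A M N)
      {p : Seminorm ℂ (BTensor A M N) // Continuous fun x : M × N => p (btmul A x.1 x.2)} :=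
  fun p => p.1

instance : UniformSpace (BTensor A M N) :=
  ⨅ p, (projectiveSeminorms A M N p).toSeminormedAddCommGroup.toUniformSpace

instance : IsUniformAddGroup (BTensor A M N) :=
  isUniformAddGroup_iInf fun p =>
    letI := (projectiveSeminorms A M N p).toSeminormedAddCommGroup
    inferInstance

set_option linter.unusedSectionVars false in
theorem withSeminorms_projectiveSeminorms : WithSeminorms (projectiveSeminorms A M N) :=
  ((projectiveSeminorms A M N).withSeminorms_iff_uniformSpace_eq_iInf).2 rfl

instance : UniformContinuousConstSMul ℂ (BTensor A M N) :=
  have : ContinuousSMul ℂ (BTensor A M N) :=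
    (withSeminorms_projectiveSeminorms A M N).continuousSMul
  uniformContinuousConstSMul_of_continuousConstSMul ℂ (BTensor A M N)

/-- The complete projective tensor product of `M` and `N` over `A`: the Hausdorff completion of
`M ⊗_A N` in its projective topology. -/
abbrev CTensor : Type u := Completion (BTensor A M N)

variable {M N}

/-- The elementary tensor `m ⊗ n` in the complete projective tensor product. -/
def ctmul (m : M) (n : N) : CTensor A M N := ((btmul A m n : BTensor A M N) : CTensor A M N)

variable {A} [TopologicalSpace A]

/-- The topological isomorphisms `j₁`, `j₂` from the complete projective tensor products of `M`
with `N` and of `N` with `M` over `A` onto `A` are convolutions, that is, bimodule isomorphisms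
making `M` and `N` topologically inverse `A`-`⊗̂`-bimodules. Bilinearity over `A` and the two
associativity squares are written out on elementary tensors, which span a dense subspace. -/
structure IsTopConvolutionPair (j₁ : CTensor A M N ≃L[ℂ] A) (j₂ : CTensor A N M ≃L[ℂ] A) :
    Prop where
  bilin₁ : ∀ (a b : A) (m : M) (n : N),
    j₁ (ctmul A (a • m) (op b • n)) = a * j₁ (ctmul A m n) * b
  bilin₂ : ∀ (a b : A) (n : N) (m : M),
    j₂ (ctmul A (a • n) (op b • m)) = a * j₂ (ctmul A n m) * b
  assoc₁ : ∀ (m : M) (n : N) (m' : M),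
    j₁ (ctmul A m n) • m' = op (j₂ (ctmul A n m')) • m
  assoc₂ : ∀ (n : N) (m : M) (n' : N),
    j₂ (ctmul A n m) • n' = op (j₁ (ctmul A m n')) • n

end Topological

end ArensMichael

/-! A bimodule isomorphic to `A_α` is a free left module on one generator, and the whole proof runs
in that coordinate. If `u` and `v` identify `M` with `A_α` and `N` with `A_{α⁻¹}`, then `m ⊗ n ↦ u m
* α (v n)` is a convolution, and its axioms reduce to associativity in `A`. Conversely, a
convolution pair forces this form: an inverse `N` of `A_α` is identified with `A_{α⁻¹}` by `α⁻¹ ∘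
i₁(1 ⊗ ·)`, and both given convolutions become the standard ones
(`IsConvolutionPair.exists_isTrivialization`). Enveloping preserves the form. By functoriality `α`
extends to `α̂`, and `Â_α̂` has the universal property of the envelope of `A_α`, because `ι` has
dense range (`IsEnvelope.isBimoduleEnvelope_twisted`). So `M̂` and `N̂` are again in coordinates,
over `α̂` and `α̂⁻¹`. Their algebraic tensor product over `Â` is already homeomorphic to the
complete space `Â`, so completing adds nothing (`IsTrivialization.exists_topConvolution`).
Compatibility with `i₁`, `i₂` is then `α̂ ∘ ι = ι ∘ α`. -/

namespace ArensMichael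

set_option linter.unusedSectionVars false

/-! ### Algebraic inverse bimodules in coordinates -/

section Trivialization

/-- The linear isomorphism `u : M ≃ A` identifies the bimodule `M` with `A_α`. -/
structure IsTrivialization {A M : Type u} [Ring A] [Algebra ℂ A] [AddCommGroup M] [Module ℂ M]
    [Module A M] [Module Aᵐᵒᵖ M] (α : A ≃ₐ[ℂ] A) (u : M ≃ₗ[ℂ] A) : Prop where
  map_left : ∀ (a : A) (m : M), u (a • m) = a * u m
  map_right : ∀ (a : A) (m : M), u (op a • m) = u m * α a

variable {A M N : Type u} [Ring A] [Algebra ℂ A]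
  [AddCommGroup M] [Module ℂ M] [Module A M] [Module Aᵐᵒᵖ M]
  [AddCommGroup N] [Module ℂ N] [Module A N] [Module Aᵐᵒᵖ N]

theorem btmul_smul (m : M) (a : A) (n : N) :
    btmul A (op a • m) n = btmul A m (a • n) :=
  (Submodule.Quotient.eq _).2 (Submodule.subset_span ⟨m, a, n, rfl⟩)

variable (A M N) in
/-- The linear map `m ↦ m ⊗ n` into `M ⊗_A N`. -/
def btmulRight (n : N) : M →ₗ[ℂ] BTensor A M N :=
  (balancing A M N).mkQ ∘ₗ (TensorProduct.mk ℂ M N).flip n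

theorem btmulRight_apply (m : M) (n : N) : btmulRight A M N n m = btmul A m n := rfl

variable (A) in
/-- The linear map out of `M ⊗_A N` induced by a balanced bilinear map. -/
def balancedLift {E : Type u} [AddCommGroup E] [Module ℂ E] (f : M →ₗ[ℂ] N →ₗ[ℂ] E)
    (hf : ∀ (m : M) (a : A) (n : N), f (op a • m) n = f m (a • n)) : BTensor A M N →ₗ[ℂ] E :=
  (balancing A M N).liftQ (TensorProduct.lift f) <| by
    rw [balancing, Submodule.span_le]
    rintro _ ⟨m, a, n, rfl⟩
    simp [hf]

theorem balancedLift_btmul {E : Type u} [AddCommGroup E] [Module ℂ E] (f : M →ₗ[ℂ] N →ₗ[ℂ] E)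
    (hf : ∀ (m : M) (a : A) (n : N), f (op a • m) n = f m (a • n)) (m : M) (n : N) :
    balancedLift A f hf (btmul A m n) = f m n := by
  change (balancing A M N).liftQ (TensorProduct.lift f) _ (Submodule.Quotient.mk _) = _
  rw [Submodule.liftQ_apply, TensorProduct.lift.tmul]

theorem BTensor.induction_on {P : BTensor A M N → Prop} (t : BTensor A M N)
    (btmul : ∀ m n, P (btmul A m n)) (add : ∀ s t, P s → P t → P (s + t)) : P t := by
  obtain ⟨t, rfl⟩ := (balancing A M N).mkQ_surjective t
  induction t with
  | zero =>
    -- Zero is itself an elementary tensor, so the principle needs no separate case for it.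
    have := btmul 0 0
    rwa [ArensMichael.btmul, TensorProduct.tmul_zero] at this
  | tmul m n => exact btmul m n
  | add s t hs ht => rw [map_add]; exact add _ _ hs ht

theorem BTensor.hom_ext {E : Type u} [AddCommGroup E] [Module ℂ E]
    {f g : BTensor A M N →ₗ[ℂ] E} (h : ∀ m n, f (btmul A m n) = g (btmul A m n)) : f = g := by
  ext t
  induction t using BTensor.induction_on with
  | btmul m n => exact h m n
  | add s t hs ht => rw [map_add, map_add, hs, ht]

variable {α : A ≃ₐ[ℂ] A} {u : M ≃ₗ[ℂ] A} {v : N ≃ₗ[ℂ] A}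

/-- The isomorphism `A_α ⊗_A A_{α⁻¹} ≃ A`, `a ⊗ b ↦ a α(b)`, transported along trivializations
of the two factors. -/
def twistedConvolution (hu : IsTrivialization α u) (hv : IsTrivialization α.symm v) :
    BTensor A M N ≃ₗ[ℂ] A :=
  LinearEquiv.ofLinearMap
    (balancedLift A ((LinearMap.mul ℂ A).compl₁₂ u.toLinearMap
      (α.toLinearMap ∘ₗ v.toLinearMap)) fun m a n => by
        simp [hu.map_right, hv.map_left, mul_assoc])
    -- The inverse is `a ↦ u⁻¹(a) ⊗ v⁻¹(1)`: since `v⁻¹(1)` generates `N` on the left, balancing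
    -- moves everything into the first factor.
    (btmulRight A M N (v.symm 1) ∘ₗ u.symm.toLinearMap)
    (by
      ext a
      simp [btmulRight_apply, balancedLift_btmul])
    (by
      refine BTensor.hom_ext fun m n => ?_
      have h₁ : u.symm (u m * α (v n)) = op (v n) • m := by
        rw [LinearEquiv.symm_apply_eq, hu.map_right]
      have h₂ : v n • v.symm 1 = n := by
        apply v.injective
        rw [hv.map_left, LinearEquiv.apply_symm_apply, mul_one]
      simp [btmulRight_apply, balancedLift_btmul, h₁, btmul_smul, h₂])

theorem twistedConvolution_btmul (hu : IsTrivialization α u) (hv : IsTrivialization α.symm v)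
    (m : M) (n : N) : twistedConvolution hu hv (btmul A m n) = u m * α (v n) := by
  simp [twistedConvolution, balancedLift_btmul]

theorem IsTrivialization.isConvolutionPair (hu : IsTrivialization α u)
    (hv : IsTrivialization α.symm v) :
    IsConvolutionPair (twistedConvolution hu hv)
      (twistedConvolution (α := α.symm) hv (α.symm_symm.symm ▸ hu)) where
  bilin₁ a b m n := by
    simp [twistedConvolution_btmul, hu.map_left, hv.map_right, mul_assoc]
  bilin₂ a b n m := by
    simp [twistedConvolution_btmul, hv.map_left, hu.map_right, mul_assoc]
  assoc₁ m n m' := u.injective <| by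
    -- `op` of a product must stay unsplit for `map_right` to apply.
    simp [twistedConvolution_btmul, hu.map_left, hu.map_right, mul_assoc, -op_mul]
  assoc₂ n m n' := v.injective <| by
    simp [twistedConvolution_btmul, hv.map_left, hv.map_right, mul_assoc, -op_mul]

theorem Twisted.isTrivialization_of_symm (α : A ≃ₐ[ℂ] A) :
    IsTrivialization α (Twisted.of (α : A →ₐ[ℂ] A)).symm where
  map_left _ _ := rfl
  map_right _ _ := rfl

/-- An inverse bimodule of `A_α` is isomorphic to `A_{α⁻¹}`, by an isomorphism identifying the
given convolutions with the standard ones. -/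
theorem IsConvolutionPair.exists_isTrivialization {α : A ≃ₐ[ℂ] A}
    {i₁ : BTensor A (Twisted (α : A →ₐ[ℂ] A)) N ≃ₗ[ℂ] A}
    {i₂ : BTensor A N (Twisted (α : A →ₐ[ℂ] A)) ≃ₗ[ℂ] A} [IsBimodule A N]
    (h : IsConvolutionPair i₁ i₂) :
    ∃ v : N ≃ₗ[ℂ] A, IsTrivialization α.symm v ∧
      (∀ m n, i₁ (btmul A m n) = (Twisted.of (α : A →ₐ[ℂ] A)).symm m * α (v n)) ∧
      ∀ n m, i₂ (btmul A n m) = v n * α.symm ((Twisted.of (α : A →ₐ[ℂ] A)).symm m) := by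
  set e := Twisted.of (α : A →ₐ[ℂ] A) with he
  have := IsBimodule.left_tower (A := A) (M := N)
  let φ : N →ₗ[ℂ] A :=
    i₁.toLinearMap ∘ₗ (balancing A (Twisted (α : A →ₐ[ℂ] A)) N).mkQ ∘ₗ
      TensorProduct.mk ℂ (Twisted (α : A →ₐ[ℂ] A)) N (e 1)
  have hφ (n) : φ n = i₁ (btmul A (e 1) n) := rfl
  have unit_smul (a : A) : op (α.symm a) • e 1 = e a := by
    rw [he, Twisted.right_smul]
    simp
  have hi₁ (m n) : i₁ (btmul A m n) = e.symm m * φ n := by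
    have h₁ := h.bilin₁ (e.symm m) 1 (e 1) n
    rw [op_one, one_smul, mul_one] at h₁
    rw [hφ, ← h₁, he, Twisted.left_smul, mul_one, LinearEquiv.apply_symm_apply]
  have hφl (a n) : φ (a • n) = α a * φ n := by
    rw [hφ, ← btmul_smul, ← α.symm_apply_apply a, unit_smul, hi₁]
    simp
  have hφr (a n) : φ (op a • n) = φ n * a := by
    rw [hφ, hφ]
    simpa using h.bilin₁ 1 a (e 1) n
  -- In `A_α` one has `m = 1 · α⁻¹(m)`, so `m ⊗ n = 1 ⊗ α⁻¹(m) n`; `ψ` reads off the second factor.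
  -- It inverts `n ↦ 1 ⊗ n`, so `φ` is bijective because `i₁` is.
  let ψ : BTensor A (Twisted (α : A →ₐ[ℂ] A)) N →ₗ[ℂ] N :=
    balancedLift A ((Algebra.lsmul ℂ ℂ N).toLinearMap ∘ₗ α.symm.toLinearMap ∘ₗ e.symm.toLinearMap)
      fun m a n => by
        have : e.symm (op a • m) = e.symm m * α a := rfl
        simp [this]
  have hψ (m n) : ψ (btmul A m n) = α.symm (e.symm m) • n := balancedLift_btmul _ _ m n
  have hbij : Function.Bijective φ := by
    refine ⟨fun n n' hn => ?_, fun a => ?_⟩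
    · have := congrArg ψ (i₁.injective hn)
      change ψ (btmul A (e 1) n) = ψ (btmul A (e 1) n') at this
      simpa [hψ] using this
    · refine ⟨ψ (i₁.symm a), ?_⟩
      have : φ ∘ₗ ψ = i₁.toLinearMap := BTensor.hom_ext fun m n => by
        simp [hψ, hφl, hi₁]
      rw [← LinearMap.comp_apply, this]
      simp
  let v : N ≃ₗ[ℂ] A := (LinearEquiv.ofBijective φ hbij).trans α.symm.toLinearEquiv
  have hv (n) : v n = α.symm (φ n) := rfl
  refine ⟨v, ⟨fun a n => ?_, fun a n => ?_⟩, fun m n => ?_, fun n m => ?_⟩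
  · simp [hv, hφl]
  · simp [hv, hφr]
  · simp [hv, hi₁]
  -- The first associativity square at the generator `1` reads `φ(n) m = α(i₂(n ⊗ m))`, so `i₁`
  -- determines `i₂`.
  · have := congrArg e.symm (h.assoc₁ (e 1) n m)
    have h₁ : e.symm (i₁ (btmul A (e 1) n) • m) = φ n * e.symm m := rfl
    have h₂ : e.symm (op (i₂ (btmul A n m)) • e 1) = α (i₂ (btmul A n m)) := one_mul _
    rw [h₁, h₂] at this
    rw [hv, ← map_mul, this, α.symm_apply_apply]

end Trivialization

/-! ### Envelopes of algebras and of twisted bimodules -/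

section Envelope

theorem IsArensMichaelAlgebra.continuousMul {B : Type u} [Ring B] [Algebra ℂ B] [UniformSpace B]
    [IsUniformAddGroup B] (h : IsArensMichaelAlgebra B) : ContinuousMul B := by
  obtain ⟨S, hS, hmul⟩ := h.mConvex
  refine ⟨continuous_iff_continuousAt.2 fun ⟨x, y⟩ => (hS.tendsto_nhds _ _).2 fun p ε hε => ?_⟩
  have hp : Continuous p.1 := hS.continuous_seminorm p
  have hc : Continuous fun z : B × B => p.1 (z.1 - x) * p.1 z.2 + p.1 x * p.1 (z.2 - y) := by
    fun_prop
  have h0 : (fun z : B × B => p.1 (z.1 - x) * p.1 z.2 + p.1 x * p.1 (z.2 - y)) (x, y) < ε := by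
    simpa using hε
  filter_upwards [hc.continuousAt.eventually_lt continuousAt_const h0] with z hz
  refine lt_of_le_of_lt ?_ hz
  have : z.1 * z.2 - x * y = (z.1 - x) * z.2 + x * (z.2 - y) := by noncomm_ring
  rw [this]
  exact (map_add_le_add _ _ _).trans (add_le_add (hmul _ p.2 _ _) (hmul _ p.2 _ _))

variable {A Ahat : Type u} [Ring A] [Algebra ℂ A] [Ring Ahat] [Algebra ℂ Ahat]
  [UniformSpace Ahat] [IsUniformAddGroup Ahat] {ι : A →ₐ[ℂ] Ahat}

instance (S : Subalgebra ℂ Ahat) : IsUniformAddGroup S :=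
  IsUniformAddGroup.comap S.val

theorem IsArensMichaelAlgebra.of_isClosed (h : IsArensMichaelAlgebra Ahat) (S : Subalgebra ℂ Ahat)
    (hS : IsClosed (S : Set Ahat)) : IsArensMichaelAlgebra S := by
  obtain ⟨P, hP, hmul⟩ := h.mConvex
  have := h.completeLCS.hausdorff
  have := h.completeLCS.complete
  have hind : Topology.IsInducing S.val.toLinearMap := .subtypeVal
  have hw := hind.withSeminorms hP
  refine ⟨⟨hw.toPolynormableSpace, inferInstance, hS.completeSpace_coe⟩,
    (fun p : Seminorm ℂ Ahat => p.comp S.val.toLinearMap) '' P, ?_, ?_⟩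
  -- Distinct seminorms may have equal restrictions; surjectivity of the reindexing suffices, since
  -- the infimum of topologies ignores repetitions.
  · let e : P → (fun p : Seminorm ℂ Ahat => p.comp S.val.toLinearMap) '' P :=
      fun p => ⟨_, p.1, p.2, rfl⟩
    have he : Function.Surjective e := by
      rintro ⟨_, p, hp, rfl⟩
      exact ⟨⟨p, hp⟩, rfl⟩
    refine (SeminormFamily.withSeminorms_iff_topologicalSpace_eq_iInf _).2 ?_
    exact ((SeminormFamily.withSeminorms_iff_topologicalSpace_eq_iInf _).1 hw).trans
      (he.iInf_comp fun q => q.1.toSeminormedAddCommGroup.toUniformSpace.toTopologicalSpace)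
  · rintro _ ⟨p, hp, rfl⟩ x y
    exact hmul p hp _ _

/-- The closure of the image is itself an Arens-Michael algebra, so `ι` factors through it; by
uniqueness the resulting map `Â → S → Â` is the identity, whence `S` is everything. -/
theorem IsEnvelope.denseRange (h : IsEnvelope ι) : DenseRange ι := by
  have := h.arensMichael.continuousMul
  have : IsTopologicalSemiring Ahat := {}
  let S := ι.range.topologicalClosure
  have hι (a) : ι a ∈ S := ι.range.le_topologicalClosure ⟨a, rfl⟩
  obtain ⟨g, hg, -⟩ := h.universal S
    (h.arensMichael.of_isClosed S ι.range.isClosed_topologicalClosure) (ι.codRestrict S hι)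
  have hid := (h.universal Ahat h.arensMichael ι).unique
    (y₁ := (⟨S.val, continuous_subtype_val⟩ : S →A[ℂ] Ahat).comp g)
    (y₂ := ContinuousAlgHom.id ℂ Ahat) (fun a => congrArg Subtype.val (hg a)) fun a => rfl
  intro x
  have hx := (g x).2
  rwa [show ((g x : S) : Ahat) = x from DFunLike.congr_fun hid x] at hx

theorem IsEnvelope.exists_continuousAlgEquiv (h : IsEnvelope ι) (α : A ≃ₐ[ℂ] A) :
    ∃ αhat : Ahat ≃A[ℂ] Ahat, ∀ a, αhat (ι a) = ι (α a) := by
  obtain ⟨f, hf, -⟩ := h.universal Ahat h.arensMichael (ι.comp α)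
  obtain ⟨g, hg, -⟩ := h.universal Ahat h.arensMichael (ι.comp α.symm)
  have hfg : f.comp g = ContinuousAlgHom.id ℂ Ahat :=
    (h.universal Ahat h.arensMichael ι).unique (fun a => by simp_all) fun a => rfl
  have hgf : g.comp f = ContinuousAlgHom.id ℂ Ahat :=
    (h.universal Ahat h.arensMichael ι).unique (fun a => by simp_all) fun a => rfl
  exact ⟨{ AlgEquiv.ofAlgHom (f : Ahat →ₐ[ℂ] Ahat) (g : Ahat →ₐ[ℂ] Ahat)
      (AlgHom.ext fun x => DFunLike.congr_fun hfg x)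
      (AlgHom.ext fun x => DFunLike.congr_fun hgf x) with
      continuous_toFun := f.cont
      continuous_invFun := g.cont }, hf⟩

theorem IsArensMichaelAlgebra.isHatBimodule_twisted (h : IsArensMichaelAlgebra Ahat)
    (β : Ahat ≃A[ℂ] Ahat) : IsHatBimodule Ahat (Twisted (β.toAlgEquiv : Ahat →ₐ[ℂ] Ahat)) := by
  have := h.continuousMul
  refine ⟨⟨h.completeLCS.1, h.completeLCS.2, h.completeLCS.3⟩, inferInstance, ?_, ?_⟩
  · exact continuous_mul (M := Ahat)
  · exact (continuous_fst.mul (β.continuous.comp continuous_snd) :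
      Continuous fun x : Ahat × Ahat => x.1 * β x.2)

variable {M : Type u} [AddCommGroup M] [Module ℂ M] [Module A M] [Module Aᵐᵒᵖ M]

/-- If `M` is identified with `A_α` by `u`, then `Â_α̂` is an envelope of `M`. -/
theorem IsEnvelope.isBimoduleEnvelope_twisted (h : IsEnvelope ι) {α : A ≃ₐ[ℂ] A}
    {β : Ahat ≃A[ℂ] Ahat} (hβ : ∀ a, β (ι a) = ι (α a)) {u : M ≃ₗ[ℂ] A}
    (hu : IsTrivialization α u) :
    IsBimoduleEnvelope ι ((Twisted.of (β.toAlgEquiv : Ahat →ₐ[ℂ] Ahat)).toLinearMap ∘ₗ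
      ι.toLinearMap ∘ₗ u.toLinearMap) := by
  set e := Twisted.of (β.toAlgEquiv : Ahat →ₐ[ℂ] Ahat) with he
  have hel (a x) : a • e x = e (a * x) := rfl
  have her (a x) : op a • e x = e (x * β a) := rfl
  refine ⟨h.arensMichael.isHatBimodule_twisted β, ⟨fun a m => ?_, fun a m => ?_⟩, ?_⟩
  · simp [hel, hu.map_left]
  · simp [her, hu.map_right, hβ]
  intro N _ _ _ _ _ _ hN f hf
  have := hN.bimodule.left_tower
  have := hN.bimodule.smul_comm
  have := hN.completeLCS.hausdorff
  set n := f (u.symm 1) with hn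
  have hcl : Continuous fun x : Ahat => x • n :=
    hN.continuous_left.comp (continuous_id.prodMk continuous_const)
  have hcr : Continuous fun x : Ahat => op x • n :=
    hN.continuous_right.comp (continuous_const.prodMk continuous_id)
  have hfm (m : M) : f m = ι (u m) • n := by
    rw [hn, ← hf.map_left]
    congr 1
    apply u.injective
    simp [hu.map_left]
  -- This makes `x ↦ x • n` right linear. It holds on `ι(A)` because `f` is a bimodule map, and
  -- extends by density and continuity of both actions.
  have hcomm (x : Ahat) : β x • n = op x • n := by
    refine congrFun (h.denseRange.equalizer (hcl.comp β.continuous) hcr ?_) x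
    ext a
    have : u (op a • u.symm 1) = α a := by simp [hu.map_right]
    simp only [Function.comp_apply]
    rw [hβ, ← this, ← hfm, hf.map_right, ← hn]
  let g : Twisted (β.toAlgEquiv : Ahat →ₐ[ℂ] Ahat) →L[ℂ] N :=
    { toLinearMap := (LinearMap.toSpanSingleton Ahat N n).restrictScalars ℂ ∘ₗ e.symm.toLinearMap
      cont := hcl }
  have hg (x) : g (e x) = x • n := rfl
  refine ⟨g, ⟨⟨fun a x => ?_, fun a x => ?_⟩, fun m => ?_⟩, ?_⟩
  · obtain ⟨x, rfl⟩ := e.surjective x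
    simp [hel, hg, mul_smul]
  · obtain ⟨x, rfl⟩ := e.surjective x
    simp [her, hg, mul_smul, hcomm, smul_comm x (op a) n]
  · simp [hg, hfm]
  · rintro g' ⟨hg', hg'f⟩
    ext x
    obtain ⟨x, rfl⟩ := e.surjective x
    -- A left linear map is determined by its value on the generator.
    have h₁ : g' (e 1) = n := by
      simpa using hg'f (u.symm 1)
    have h₂ := hg'.map_left x (e 1)
    rw [hel, mul_one] at h₂
    rw [hg, ← h₁]
    exact h₂

theorem IsBimoduleHom.comp {Phat Qhat Rhat : Type u}
    [AddCommGroup Phat] [Module ℂ Phat] [Module Ahat Phat] [Module Ahatᵐᵒᵖ Phat]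
    [AddCommGroup Qhat] [Module ℂ Qhat] [Module Ahat Qhat] [Module Ahatᵐᵒᵖ Qhat]
    [AddCommGroup Rhat] [Module ℂ Rhat] [Module Ahat Rhat] [Module Ahatᵐᵒᵖ Rhat]
    {g : Qhat →ₗ[ℂ] Rhat} {f : Phat →ₗ[ℂ] Qhat}
    (hg : IsBimoduleHom (AlgHom.id ℂ Ahat) g) (hf : IsBimoduleHom (AlgHom.id ℂ Ahat) f) :
    IsBimoduleHom (AlgHom.id ℂ Ahat) (g ∘ₗ f) where
  map_left a m := by
    simp only [LinearMap.comp_apply]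
    rw [hf.map_left, hg.map_left]; rfl
  map_right a m := by
    simp only [LinearMap.comp_apply]
    rw [hf.map_right, hg.map_right]; rfl

theorem IsBimoduleEnvelope.exists_continuousLinearEquiv {Phat Qhat : Type u}
    [AddCommGroup Phat] [Module ℂ Phat] [Module Ahat Phat] [Module Ahatᵐᵒᵖ Phat]
    [UniformSpace Phat] [IsUniformAddGroup Phat]
    [AddCommGroup Qhat] [Module ℂ Qhat] [Module Ahat Qhat] [Module Ahatᵐᵒᵖ Qhat]
    [UniformSpace Qhat] [IsUniformAddGroup Qhat]
    {i : M →ₗ[ℂ] Phat} {j : M →ₗ[ℂ] Qhat}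
    (hi : IsBimoduleEnvelope ι i) (hj : IsBimoduleEnvelope ι j) :
    ∃ e : Phat ≃L[ℂ] Qhat,
      IsBimoduleHom (AlgHom.id ℂ Ahat) (e : Phat →ₗ[ℂ] Qhat) ∧ ∀ m, e (i m) = j m := by
  obtain ⟨f, ⟨hf, hfi⟩, -⟩ := hi.universal Qhat hj.hatBimodule j hj.hom
  obtain ⟨g, ⟨hg, hgj⟩, -⟩ := hj.universal Phat hi.hatBimodule i hi.hom
  have hgf : g.comp f = ContinuousLinearMap.id ℂ Phat :=
    (hi.universal Phat hi.hatBimodule i hi.hom).unique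
      ⟨hg.comp hf, fun m => by simp [hfi, hgj]⟩ ⟨⟨fun _ _ => rfl, fun _ _ => rfl⟩, fun _ => rfl⟩
  have hfg : f.comp g = ContinuousLinearMap.id ℂ Qhat :=
    (hj.universal Qhat hj.hatBimodule j hj.hom).unique
      ⟨hf.comp hg, fun m => by simp [hfi, hgj]⟩ ⟨⟨fun _ _ => rfl, fun _ _ => rfl⟩, fun _ => rfl⟩
  exact ⟨ContinuousLinearEquiv.equivOfInverse f g (DFunLike.congr_fun hgf)
    (DFunLike.congr_fun hfg), hf, hfi⟩

/-- Envelopes are unique up to isomorphism, so coordinates on the model `Â_α̂` transfer to an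
arbitrary envelope. -/
theorem IsBimoduleEnvelope.exists_isTrivialization {Mhat : Type u}
    [AddCommGroup Mhat] [Module ℂ Mhat] [Module Ahat Mhat] [Module Ahatᵐᵒᵖ Mhat]
    [UniformSpace Mhat] [IsUniformAddGroup Mhat] {i : M →ₗ[ℂ] Mhat}
    (hi : IsBimoduleEnvelope ι i) (h : IsEnvelope ι) {α : A ≃ₐ[ℂ] A} {β : Ahat ≃A[ℂ] Ahat}
    (hβ : ∀ a, β (ι a) = ι (α a)) {u : M ≃ₗ[ℂ] A} (hu : IsTrivialization α u) :
    ∃ w : Mhat ≃L[ℂ] Ahat, IsTrivialization β.toAlgEquiv w.toLinearEquiv ∧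
      ∀ m, w (i m) = ι (u m) := by
  obtain ⟨e, he, hei⟩ :=
    hi.exists_continuousLinearEquiv (h.isBimoduleEnvelope_twisted hβ hu)
  let o : Twisted (β.toAlgEquiv : Ahat →ₐ[ℂ] Ahat) ≃L[ℂ] Ahat :=
    { (Twisted.of (β.toAlgEquiv : Ahat →ₐ[ℂ] Ahat)).symm with
      continuous_toFun := (continuous_id : Continuous (id : Ahat → Ahat))
      continuous_invFun := (continuous_id : Continuous (id : Ahat → Ahat)) }
  exact ⟨e.trans o, ⟨fun a m => congrArg o (he.map_left a m), fun a m =>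
    congrArg o (he.map_right a m)⟩, fun m => congrArg o (hei m)⟩

end Envelope

/-! ### Topological convolutions -/

section Convolution

variable {B M N : Type u} [Ring B] [Algebra ℂ B] [UniformSpace B] [IsUniformAddGroup B]
  [AddCommGroup M] [Module ℂ M] [Module B M] [Module Bᵐᵒᵖ M] [TopologicalSpace M]
  [AddCommGroup N] [Module ℂ N] [Module B N] [Module Bᵐᵒᵖ N] [TopologicalSpace N]

/-- A continuous linear equivalence onto a complete Hausdorff space extends to the completion. -/
theorem exists_completion_equiv {E F : Type u} [AddCommGroup E] [Module ℂ E] [UniformSpace E]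
    [IsUniformAddGroup E] [UniformContinuousConstSMul ℂ E] [AddCommGroup F] [Module ℂ F]
    [UniformSpace F] [IsUniformAddGroup F] [ContinuousConstSMul ℂ F] [T2Space F] [CompleteSpace F]
    (e : E ≃L[ℂ] F) : ∃ j : Completion E ≃L[ℂ] F, ∀ x : E, j x = e x := by
  have he : UniformContinuous e := (e : E →L[ℂ] F).uniformContinuous
  have hc : Continuous (Completion.extension e) := Completion.continuous_extension
  have hj (x : E) : Completion.extension e x = e x := Completion.extension_coe he x
  refine ⟨⟨⟨⟨⟨Completion.extension e, fun x y => ?_⟩, fun c x => ?_⟩,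
    fun y => ((e.symm y : E) : Completion E), fun x => ?_, fun y => ?_⟩, hc,
    (Completion.continuous_coe E).comp e.symm.continuous⟩, hj⟩
  · refine Completion.induction_on₂ x y (isClosed_eq (by fun_prop) (by fun_prop)) fun x y => ?_
    rw [← Completion.coe_add, hj, hj, hj, map_add]
  · refine Completion.induction_on x (isClosed_eq (hc.comp (continuous_const_smul c))
      (hc.const_smul _)) fun x => ?_
    simp only [RingHom.id_apply]
    rw [← Completion.coe_smul, hj, hj, map_smul]
  · refine Completion.induction_on x (isClosed_eq ((Completion.continuous_coe E).comp
      (e.symm.continuous.comp hc)) continuous_id) fun x => ?_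
    simp only [hj, e.symm_apply_apply]
  · simp only [hj, e.apply_symm_apply]

theorem IsTrivialization.exists_topConvolution (hB : IsArensMichaelAlgebra B)
    {β : B ≃A[ℂ] B} {u : M ≃L[ℂ] B} {v : N ≃L[ℂ] B}
    (hu : IsTrivialization β.toAlgEquiv u.toLinearEquiv)
    (hv : IsTrivialization β.toAlgEquiv.symm v.toLinearEquiv) :
    ∃ j : CTensor B M N ≃L[ℂ] B, ∀ m n, j (ctmul B m n) = u m * β (v n) := by
  have := hB.continuousMul
  have := hB.completeLCS.hausdorff
  have := hB.completeLCS.complete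
  have := hB.completeLCS.locallyConvex
  have hw := PolynormableSpace.withSeminorms ℂ B
  have := hw.continuousSMul
  let t := twistedConvolution hu hv
  have ht (m n) : t (btmul B m n) = u m * β (v n) := twistedConvolution_btmul hu hv m n
  -- Pulling a continuous seminorm of `B` back along `t` gives one of the seminorms defining the
  -- projective topology, by joint continuity of multiplication.
  have hcont : Continuous t.toLinearMap := by
    refine hw.continuous_of_continuous_comp _ fun p => ?_
    refine (withSeminorms_projectiveSeminorms B M N).continuous_seminorm
      ⟨p.1.comp t.toLinearMap, ?_⟩
    change Continuous fun x : M × N => p.1 (t (btmul B x.1 x.2))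
    simp only [ht]
    exact p.2.comp ((u.continuous.comp continuous_fst).mul
      (β.continuous.comp (v.continuous.comp continuous_snd)))
  have hcont' : Continuous t.symm.toLinearMap := by
    refine (withSeminorms_projectiveSeminorms B M N).continuous_of_continuous_comp _ fun p => ?_
    -- The inverse is `b ↦ u⁻¹(b) ⊗ v⁻¹(1)`, so a slice of the joint continuity of `p` is enough.
    exact p.2.comp (u.symm.continuous.prodMk (continuous_const (y := v.symm 1)))
  obtain ⟨j, hj⟩ := exists_completion_equiv
    (⟨t, hcont, hcont'⟩ : BTensor B M N ≃L[ℂ] B)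
  exact ⟨j, fun m n => (hj _).trans (ht m n)⟩

theorem IsTrivialization.isTopConvolutionPair {β : B ≃A[ℂ] B} {u : M ≃L[ℂ] B} {v : N ≃L[ℂ] B}
    (hu : IsTrivialization β.toAlgEquiv u.toLinearEquiv)
    (hv : IsTrivialization β.toAlgEquiv.symm v.toLinearEquiv)
    {j₁ : CTensor B M N ≃L[ℂ] B} {j₂ : CTensor B N M ≃L[ℂ] B}
    (h₁ : ∀ m n, j₁ (ctmul B m n) = u m * β (v n))
    (h₂ : ∀ n m, j₂ (ctmul B n m) = v n * β.symm (u m)) : IsTopConvolutionPair j₁ j₂ := by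
  have hul (a : B) (m : M) : u (a • m) = a * u m := hu.map_left a m
  have hur (a : B) (m : M) : u (op a • m) = u m * β a := hu.map_right a m
  have hvl (a : B) (n : N) : v (a • n) = a * v n := hv.map_left a n
  have hvr (a : B) (n : N) : v (op a • n) = v n * β.symm a := hv.map_right a n
  refine ⟨fun a b m n => ?_, fun a b n m => ?_, fun m n m' => u.injective ?_,
    fun n m n' => v.injective ?_⟩
  · simp [h₁, hul, hvr, mul_assoc]
  · simp [h₂, hvl, hur, mul_assoc]
  · simp [h₁, h₂, hul, hur, mul_assoc, -op_mul]
  · simp [h₁, h₂, hvl, hvr, mul_assoc, -op_mul]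

end Convolution

end ArensMichael

theorem proposition2p3 (A : Type u) [Ring A] [Algebra ℂ A] (α : A ≃ₐ[ℂ] A) :
    -- `A_α` is invertible, with inverse `A_{α⁻¹}` and the standard convolutions
    (∃ (i₁ : ArensMichael.BTensor A (ArensMichael.Twisted (α : A →ₐ[ℂ] A))
            (ArensMichael.Twisted (α.symm : A →ₐ[ℂ] A)) ≃ₗ[ℂ] A)
        (i₂ : ArensMichael.BTensor A (ArensMichael.Twisted (α.symm : A →ₐ[ℂ] A))
            (ArensMichael.Twisted (α : A →ₐ[ℂ] A)) ≃ₗ[ℂ] A),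
      ArensMichael.IsConvolutionPair i₁ i₂ ∧
      (∀ a b : A, i₁ (ArensMichael.btmul A (ArensMichael.Twisted.of (α : A →ₐ[ℂ] A) a)
        (ArensMichael.Twisted.of (α.symm : A →ₐ[ℂ] A) b)) = a * α b) ∧
      (∀ a b : A, i₂ (ArensMichael.btmul A (ArensMichael.Twisted.of (α.symm : A →ₐ[ℂ] A) b)
        (ArensMichael.Twisted.of (α : A →ₐ[ℂ] A) a)) = b * α.symm a)) ∧
    ∀ (Ahat : Type u) [Ring Ahat] [Algebra ℂ Ahat] [UniformSpace Ahat] [IsUniformAddGroup Ahat]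
      (ι : A →ₐ[ℂ] Ahat), ArensMichael.IsEnvelope ι →
    -- the envelope of `A_α` is `Â_α̂`
    (∃ αhat : Ahat ≃A[ℂ] Ahat, (∀ a : A, αhat (ι a) = ι (α a)) ∧
      ArensMichael.IsBimoduleEnvelope ι
        ((ArensMichael.Twisted.of (αhat.toAlgEquiv : Ahat →ₐ[ℂ] Ahat)).toLinearMap ∘ₗ
          ι.toLinearMap ∘ₗ
          (ArensMichael.Twisted.of (α : A →ₐ[ℂ] A)).symm.toLinearMap)) ∧
    -- for every inverse `N` of `A_α`, the envelopes of `A_α` and `N` are topologically inverse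
    -- with convolutions compatible with the algebraic ones
    ∀ (N : Type u) [AddCommGroup N] [Module ℂ N] [Module A N] [Module Aᵐᵒᵖ N]
      [ArensMichael.IsBimodule A N]
      (i₁ : ArensMichael.BTensor A (ArensMichael.Twisted (α : A →ₐ[ℂ] A)) N ≃ₗ[ℂ] A)
      (i₂ : ArensMichael.BTensor A N (ArensMichael.Twisted (α : A →ₐ[ℂ] A)) ≃ₗ[ℂ] A),
      ArensMichael.IsConvolutionPair i₁ i₂ →
    ∀ (Mhat : Type u) [AddCommGroup Mhat] [Module ℂ Mhat] [Module Ahat Mhat]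
      [Module Ahatᵐᵒᵖ Mhat] [UniformSpace Mhat] [IsUniformAddGroup Mhat]
      (iM : ArensMichael.Twisted (α : A →ₐ[ℂ] A) →ₗ[ℂ] Mhat),
      ArensMichael.IsBimoduleEnvelope ι iM →
    ∀ (Nhat : Type u) [AddCommGroup Nhat] [Module ℂ Nhat] [Module Ahat Nhat]
      [Module Ahatᵐᵒᵖ Nhat] [UniformSpace Nhat] [IsUniformAddGroup Nhat]
      (iN : N →ₗ[ℂ] Nhat), ArensMichael.IsBimoduleEnvelope ι iN →
    ∃ (j₁ : ArensMichael.CTensor Ahat Mhat Nhat ≃L[ℂ] Ahat)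
      (j₂ : ArensMichael.CTensor Ahat Nhat Mhat ≃L[ℂ] Ahat),
      ArensMichael.IsTopConvolutionPair j₁ j₂ ∧
      (∀ (m : ArensMichael.Twisted (α : A →ₐ[ℂ] A)) (n : N),
        j₁ (ArensMichael.ctmul Ahat (iM m) (iN n)) = ι (i₁ (ArensMichael.btmul A m n))) ∧
      (∀ (n : N) (m : ArensMichael.Twisted (α : A →ₐ[ℂ] A)),
        j₂ (ArensMichael.ctmul Ahat (iN n) (iM m)) = ι (i₂ (ArensMichael.btmul A n m))) := by
  refine ⟨⟨_, _, (ArensMichael.Twisted.isTrivialization_of_symm α).isConvolutionPair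
    (ArensMichael.Twisted.isTrivialization_of_symm α.symm), fun a b => ?_, fun a b => ?_⟩, ?_⟩
  · exact ArensMichael.twistedConvolution_btmul _ _ _ _
  · exact ArensMichael.twistedConvolution_btmul (α := α.symm) _ _ _ _
  intro Ahat _ _ _ _ ι hι
  obtain ⟨αhat, hα⟩ := hι.exists_continuousAlgEquiv α
  have hα' (a : A) : αhat.symm (ι a) = ι (α.symm a) := by
    rw [ContinuousAlgEquiv.symm_apply_eq, hα, α.apply_symm_apply]
  refine ⟨⟨αhat, hα, hι.isBimoduleEnvelope_twisted hα
    (ArensMichael.Twisted.isTrivialization_of_symm α)⟩, ?_⟩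
  intro N _ _ _ _ _ i₁ i₂ hi Mhat _ _ _ _ _ _ iM hM Nhat _ _ _ _ _ _ iN hN
  obtain ⟨v, hv, hi₁, hi₂⟩ := hi.exists_isTrivialization
  obtain ⟨uhat, huhat, hu⟩ := hM.exists_isTrivialization hι hα
    (ArensMichael.Twisted.isTrivialization_of_symm α)
  obtain ⟨vhat, hvhat, hv⟩ := hN.exists_isTrivialization hι hα' hv
  obtain ⟨j₁, hj₁⟩ := huhat.exists_topConvolution hι.arensMichael hvhat
  -- The same construction with the factors exchanged and `α̂⁻¹` as the twist; its inverse unfolds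
  -- to `α̂`.
  obtain ⟨j₂, hj₂⟩ := hvhat.exists_topConvolution hι.arensMichael huhat
  refine ⟨j₁, j₂, huhat.isTopConvolutionPair hvhat hj₁ hj₂, fun m n => ?_, fun n m => ?_⟩
  · rw [hj₁, hi₁, hu, hv, hα, map_mul]
  · rw [hj₂, hi₂, hu, hv, hα', map_mul]
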